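/- Let $H$ be a complex Hilbert space and let $A\subseteq B(H)$ be a factor, that is, a von Neumann algebra whose center is $\mathbb{C}1$. Let $\Gamma^{+}(A)$ be the undirected graph whose vertices are the nonzero positive zero divisors of $A$, i.e. the nonzero elements $a\in A$ of the form $a=cc^{*}$ with $c\in A$ for which there is a nonzero $b\in A$ with $ab=0$ or $ba=0$, and in which two distinct vertices $a,b$ are joined by an edge if and only if $ab=0$. If $\dim_{\mathbb{C}}A\geq 5$ (equivalently, $A\neq 0$ is isomorphic neither to $\mathbb{C}$ nor to $M_2(\mathbb{C})$), then $\Gamma^{+}(A)$ is connected and its diameter (the supremum over all pairs of vertices of the length of a shortest path between them) is at most $4$; in particular it is at most $6$. -/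

import Mathlib

/-- A von Neumann algebra `A ⊆ B(H)` is a factor if its center is trivial: every element of `A`
that commutes with all of `A` is a scalar multiple of the identity. -/
def VonNeumannAlgebra.IsFactor {H : Type*} [NormedAddCommGroup H] [InnerProductSpace ℂ H]
    [CompleteSpace H] (A : VonNeumannAlgebra H) : Prop :=
  ∀ z ∈ A, (∀ a ∈ A, z * a = a * z) → ∃ c : ℂ, z = c • (1 : H →L[ℂ] H)

/-- `a` is a nonzero positive zero divisor of the star ring `A`: it is nonzero, it has the form
`c * star c` with `c ∈ A`, and `a * b = 0` or `b * a = 0` for some nonzero `b ∈ A`. -/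
def IsPosZeroDivisor {A : Type*} [NonUnitalRing A] [StarRing A] (a : A) : Prop :=
  a ≠ 0 ∧ (∃ c : A, a = c * star c) ∧ ∃ b : A, b ≠ 0 ∧ (a * b = 0 ∨ b * a = 0)

theorem IsPosZeroDivisor.star_eq {A : Type*} [NonUnitalRing A] [StarRing A] {a : A}
    (ha : IsPosZeroDivisor a) : star a = a := by
  obtain ⟨-, ⟨c, rfl⟩, -⟩ := ha
  simp

/-- The positive zero divisor graph: its vertices are the nonzero positive zero divisors of `A`,
and distinct vertices `a`, `b` are joined by an edge if and only if `a * b = 0`. -/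
def posZeroDivisorGraph (A : Type*) [NonUnitalRing A] [StarRing A] :
    SimpleGraph {a : A // IsPosZeroDivisor a} where
  Adj a b := a ≠ b ∧ (a : A) * (b : A) = 0
  symm := ⟨fun a b h => ⟨h.1.symm, by
    have h' := congrArg star h.2
    rwa [star_mul, star_zero, a.2.star_eq, b.2.star_eq] at h'⟩⟩
  loopless := ⟨fun _ h => h.1 rfl⟩

/-! Take vertices u, v and let N be the two-sided annihilator of v. If x u y = 0 with x, y nonzero
in N, then u and v are at distance at most 4. Indeed, pick d ≠ 0 with u d = 0: either x u = 0 and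
x*x is a common neighbour, or x u annihilates both d and y, and the path runs through dd*,
(xu)*(xu), yy*.

Otherwise the form x u y has no zero divisors on N, and functional calculus forces N to be spanned
by one projection q (`exists_projection_of_sandwich_prime`). By symmetry the annihilator of u is
spanned by a projection p. Both are minimal, and dimension at least 5 leaves room for some x ≠ 0
with x p = x q = 0 (`exists_annihilator_of_minimal`), which again gives a path of length at most 4.
-/

/-! ### Spectral separation by functional calculus. -/

/-- A nonzero self-adjoint element `h` of a C⋆-algebra is either a nonzero multiple of an
idempotent, or two distinct nonzero points of its spectrum are separated by orthogonal elements. -/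
theorem IsSelfAdjoint.mul_self_eq_smul_or_exists_orthogonal {A : Type*} [CStarAlgebra A] {h : A}
    (hh : IsSelfAdjoint h) (h0 : h ≠ 0) :
    (∃ r : ℝ, r ≠ 0 ∧ h * h = (r : ℂ) • h) ∨
      ∃ u v : A, h * u * h ≠ 0 ∧ h * v * h ≠ 0 ∧ h * u * h * (v * h) = 0 := by
  have separated : ∀ s ∈ spectrum ℝ h, ∀ t ∈ spectrum ℝ h, s ≠ 0 → t ≠ 0 → s < t →
      ∃ u v : A, h * u * h ≠ 0 ∧ h * v * h ≠ 0 ∧ h * u * h * (v * h) = 0 := by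
    intro s hs t ht hs0 ht0 hst
    have hid : cfc (fun x : ℝ => x) h = h := cfc_id' ℝ h
    have sandwich : ∀ f : ℝ → ℝ, Continuous f →
        h * cfc f h * h = cfc (fun x => x * f x * x) h := by
      intro f hf
      rw [cfc_mul (fun x : ℝ => x * f x) (fun x : ℝ => x) h (by fun_prop) (by fun_prop),
        cfc_mul (fun x : ℝ => x) f h (by fun_prop) (by fun_prop), hid]
    have ne_zero : ∀ (f : ℝ → ℝ) (x : ℝ), x ∈ spectrum ℝ h → f x ≠ 0 → Continuous f →
        cfc f h ≠ 0 := by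
      intro f x hx hfx hf h0
      rw [← cfc_zero ℝ h] at h0
      exact hfx (eqOn_of_cfc_eq_cfc h0 (hf.continuousOn) (by fun_prop) hh hx)
    -- Cutting at the midpoint of s and t gives two functions with product zero, one nonzero at t,
    -- the other at s.
    have hu : Continuous fun x : ℝ => max (x - (s + t) / 2) 0 := by fun_prop
    have hv : Continuous fun x : ℝ => max ((s + t) / 2 - x) 0 := by fun_prop
    refine ⟨cfc (fun x : ℝ => max (x - (s + t) / 2) 0) h,
      cfc (fun x : ℝ => max ((s + t) / 2 - x) 0) h, ?_, ?_, ?_⟩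
    · rw [sandwich _ hu]
      refine ne_zero _ t ht ?_ (by fun_prop)
      have : 0 < max (t - (s + t) / 2) 0 := lt_max_of_lt_left (by linarith)
      positivity
    · rw [sandwich _ hv]
      refine ne_zero _ s hs ?_ (by fun_prop)
      have : 0 < max ((s + t) / 2 - s) 0 := lt_max_of_lt_left (by linarith)
      positivity
    · rw [sandwich _ hu, ← mul_assoc,
        ← cfc_mul _ _ h (by fun_prop) (by fun_prop)]
      have : (fun x : ℝ => x * max (x - (s + t) / 2) 0 * x * max ((s + t) / 2 - x) 0) =
          fun _ => 0 := by
        funext x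
        rcases le_total x ((s + t) / 2) with hx | hx
        · rw [max_eq_right (by linarith : x - (s + t) / 2 ≤ 0)]; ring
        · rw [max_eq_right (by linarith : (s + t) / 2 - x ≤ 0)]; ring
      rw [this, cfc_const_zero, zero_mul]
  by_cases hone : ∃ r ∈ spectrum ℝ h, r ≠ 0 ∧ ∀ s ∈ spectrum ℝ h, s ≠ 0 → s = r
  · obtain ⟨r, -, hr0, hr⟩ := hone
    refine Or.inl ⟨r, hr0, ?_⟩
    have hsq : cfc (fun x : ℝ => x * x) h = cfc (fun x : ℝ => r * x) h := by
      refine cfc_congr fun x hx => ?_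
      by_cases hx0 : x = 0
      · simp [hx0]
      · simp [hr x hx hx0]
    rw [cfc_mul (fun x : ℝ => x) (fun x : ℝ => x) h, cfc_const_mul r (fun x : ℝ => x) h,
      cfc_id' ℝ h] at hsq
    rw [hsq, Complex.coe_smul]
  · right
    by_cases hz : ∃ r ∈ spectrum ℝ h, r ≠ 0
    · obtain ⟨r, hr, hr0⟩ := hz
      push Not at hone
      obtain ⟨s, hs, hs0, hsr⟩ := hone r hr hr0
      rcases lt_or_gt_of_ne hsr with hlt | hlt
      · exact separated s hs r hr hs0 hr0 hlt
      · exact separated r hr s hs hr0 hs0 hlt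
    · push Not at hz
      refine absurd ?_ h0
      rw [← cfc_id' ℝ h, ← cfc_zero ℝ h]
      exact cfc_congr fun x hx => hz x hx

/-! ### Hereditary subspaces without sandwich zero divisors. -/

section Hereditary

variable {A : Type*} [CStarAlgebra A] {N : Submodule ℂ A} {a : A}

/-- If `b₁ * a * b₂ = 0` forces `b₁ = 0` or `b₂ = 0` in a hereditary subspace `N`, then each nonzero
self-adjoint element `b` of `N` is supported on a unit of `N`. -/
theorem exists_unit_of_sandwich_prime (hstar : ∀ z ∈ N, star z ∈ N)
    (hher : ∀ x ∈ N, ∀ y ∈ N, ∀ t, x * t * y ∈ N) (ha : IsSelfAdjoint a)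
    (hprime : ∀ x ∈ N, ∀ y ∈ N, x * a * y = 0 → x = 0 ∨ y = 0)
    {b : A} (hb : b ∈ N) (hbs : IsSelfAdjoint b) (hb0 : b ≠ 0) :
    ∃ p ∈ N, IsSelfAdjoint p ∧ (∀ z ∈ N, z * p = z) ∧ (∀ z ∈ N, p * z = z) ∧
      (∃ c : ℂ, b * a * b = c • p) ∧
      ∃ c : ℂ, c ≠ 0 ∧ ∀ z ∈ N, c • z = z * a * p := by
  have hmul : ∀ x ∈ N, ∀ y ∈ N, x * y ∈ N := fun x hx y hy => by
    simpa using hher x hx y hy 1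
  have support : ∀ b ∈ N, IsSelfAdjoint b → b ≠ 0 → ∃ p ∈ N, IsSelfAdjoint p ∧ p * p = p ∧
      p * b = b ∧ ∃ c : ℂ, c ≠ 0 ∧ b * a * b = c • p := by
    intro b hb hbs hb0
    have hhs : IsSelfAdjoint (b * a * b) := by
      simp [IsSelfAdjoint, hbs.star_eq, ha.star_eq, mul_assoc]
    have hh0 : b * a * b ≠ 0 := fun h => by simpa [hb0] using hprime b hb b hb h
    have hhN : b * a * b ∈ N := hher b hb b hb a
    rcases hhs.mul_self_eq_smul_or_exists_orthogonal hh0 with ⟨r, hr0, hr⟩ | ⟨u, v, hu, hv, huv⟩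
    · have hrc : (r : ℂ) ≠ 0 := by exact_mod_cast hr0
      have hpp : ((r : ℂ)⁻¹ • (b * a * b)) * ((r : ℂ)⁻¹ • (b * a * b)) =
          (r : ℂ)⁻¹ • (b * a * b) := by
        rw [smul_mul_smul_comm, hr, smul_smul, mul_assoc, inv_mul_cancel₀ hrc, mul_one]
      have hpN : (r : ℂ)⁻¹ • (b * a * b) ∈ N := N.smul_mem _ hhN
      refine ⟨(r : ℂ)⁻¹ • (b * a * b), hpN, ?_, hpp, ?_, r, hrc, ?_⟩
      · rw [IsSelfAdjoint, star_smul, hhs.star_eq]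
        congr 1
        simp
      · have hz : ((r : ℂ)⁻¹ • (b * a * b) * b - b) * a * b = 0 := by
          have : (r : ℂ)⁻¹ • (b * a * b) * b * a * b = b * a * b := by
            have : (r : ℂ)⁻¹ • (b * a * b) * b * a * b =
              (r : ℂ)⁻¹ • ((b * a * b) * (b * a * b)) := by
              simp only [smul_mul_assoc, mul_assoc]
            rw [this, hr, smul_smul, inv_mul_cancel₀ hrc, one_smul]
          rw [sub_mul, sub_mul, this, sub_self]
        rcases hprime _ (N.sub_mem (hmul _ hpN _ hb) hb) _ hb hz with h | h
        · exact sub_eq_zero.mp h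
        · exact absurd h hb0
      · rw [smul_smul, mul_inv_cancel₀ hrc, one_smul]
    · exfalso
      -- With h = b a b, the elements h u b and b v h of N satisfy (h u b) a (b v h) = h u h v h =
      -- 0, against `hprime`.
      have h1 : (b * a * b) * u * b ∈ N := hher _ hhN _ hb u
      have h2 : b * v * (b * a * b) ∈ N := hher _ hb _ hhN v
      have h12 : (b * a * b) * u * b * a * (b * v * (b * a * b)) = 0 := by
        rw [← huv]; simp only [mul_assoc]
      rcases hprime _ h1 _ h2 h12 with h | h
      · apply hu
        rw [show (b * a * b) * u * (b * a * b) = (b * a * b) * u * b * (a * b) by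
          simp only [mul_assoc], h, zero_mul]
      · apply hv
        rw [show (b * a * b) * v * (b * a * b) = b * a * (b * v * (b * a * b)) by
          simp only [mul_assoc], h, mul_zero]
  obtain ⟨p, hp, hps, hpp, hpb, c, -, hc⟩ := support b hb hbs hb0
  have hp0 : p ≠ 0 := by
    rintro rfl
    exact hb0 (by simpa using hpb.symm)
  -- Applying `support` to p itself gives q = p, so that p a p is a nonzero multiple of p.
  obtain ⟨q, hq, hqs, hqq, hqp, d, hd0, hd⟩ := support p hp hps hp0
  have hpq : p * q = p := by
    have := congrArg star hqp
    rwa [star_mul, hps.star_eq, hqs.star_eq] at this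
  have hpq' : p * q = q := by
    have : d • (p * q) = d • q := by
      rw [← mul_smul_comm, ← hd, ← mul_assoc, ← mul_assoc, hpp]
    simpa [hd0] using this
  obtain rfl : p = q := hpq.symm.trans hpq'
  have hunit : ∀ z ∈ N, d • z = z * a * p := by
    intro z hz
    have hw : d • z - z * a * p ∈ N := N.sub_mem (N.smul_mem _ hz) (hher z hz p hp a)
    have h0 : (d • z - z * a * p) * a * p = 0 := by
      have : z * a * p * a * p = d • (z * a * p) := by
        rw [← mul_smul_comm, ← hd]; simp only [mul_assoc]
      rw [sub_mul, sub_mul, this, smul_mul_assoc, smul_mul_assoc, sub_self]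
    exact sub_eq_zero.mp ((hprime _ hw _ hp h0).resolve_right hp0)
  have hright : ∀ z ∈ N, z * p = z := by
    intro z hz
    have : d • (z * p) = d • z := by
      rw [← smul_mul_assoc, hunit z hz, mul_assoc, hpp]
    simpa [hd0] using this
  refine ⟨p, hp, hps, hright, fun z hz => ?_, ⟨c, hc⟩, d, hd0, hunit⟩
  have := congrArg star (hright _ (hstar z hz))
  rwa [star_mul, star_star, hps.star_eq] at this

/-- If `b₁ * a * b₂ = 0` forces `b₁ = 0` or `b₂ = 0` in a hereditary subspace `N`, then `N` is
spanned by a projection. -/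
theorem exists_projection_of_sandwich_prime (hstar : ∀ z ∈ N, star z ∈ N)
    (hher : ∀ x ∈ N, ∀ y ∈ N, ∀ t, x * t * y ∈ N) (ha : IsSelfAdjoint a)
    (hprime : ∀ x ∈ N, ∀ y ∈ N, x * a * y = 0 → x = 0 ∨ y = 0) :
    ∃ p ∈ N, IsSelfAdjoint p ∧ p * p = p ∧ ∀ z ∈ N, ∃ c : ℂ, z = c • p := by
  by_cases hN : ∃ b ∈ N, b ≠ 0 ∧ IsSelfAdjoint b
  · obtain ⟨b, hb, hb0, hbs⟩ := hN
    obtain ⟨p, hp, hps, hpr, hpl, -, d, hd0, hd⟩ :=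
      exists_unit_of_sandwich_prime hstar hher ha hprime hb hbs hb0
    have hquad : ∀ z ∈ N, IsSelfAdjoint z → ∃ c : ℂ, z * a * z = c • p := by
      intro z hz hzs
      by_cases hz0 : z = 0
      · exact ⟨0, by simp [hz0]⟩
      · obtain ⟨q, hq, -, hqr, -, ⟨c, hc⟩, -⟩ :=
          exists_unit_of_sandwich_prime hstar hher ha hprime hz hzs hz0
        exact ⟨c, by rw [hc, ← hpl q hq, hqr p hp]⟩
    have hsa : ∀ z ∈ N, IsSelfAdjoint z → ∃ c : ℂ, z = c • p := by
      intro z hz hzs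
      obtain ⟨c₁, h₁⟩ := hquad z hz hzs
      obtain ⟨c₂, h₂⟩ := hquad p hp hps
      obtain ⟨c₃, h₃⟩ := hquad (z + p) (N.add_mem hz hp) (hzs.add hps)
      have hsym : star d • z = p * a * z := by
        have := congrArg star (hd z hz)
        simpa [hzs.star_eq, hps.star_eq, ha.star_eq, mul_assoc] using this
      have hdr : star d = d := by
        have h1 : d • p = p * a * p := hd p hp
        have h2 := congrArg star h1
        rw [star_smul, hps.star_eq, show star (p * a * p) = p * a * p by
          simp [hps.star_eq, ha.star_eq, mul_assoc], ← h1] at h2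
        have hp0 : p ≠ 0 := by
          rintro rfl
          exact hb0 (by simpa using (hpr b hb).symm)
        exact smul_left_injective ℂ hp0 h2
      rw [hdr] at hsym
      -- Polarization of z ↦ z a z: the cross terms z a p and p a z both equal d z.
      have h2z : (2 * d) • z = (c₃ - c₁ - c₂) • p := by
        rw [sub_smul, sub_smul, ← h₁, ← h₂, ← h₃, mul_smul, two_smul]
        nth_rewrite 1 [hd z hz]
        rw [hsym]
        noncomm_ring
      have h2d : (2 * d) ≠ 0 := mul_ne_zero two_ne_zero hd0
      exact ⟨(2 * d)⁻¹ * (c₃ - c₁ - c₂), by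
        rw [mul_smul, ← h2z, smul_smul, inv_mul_cancel₀ h2d, one_smul]⟩
    refine ⟨p, hp, hps, hpr p hp, fun z hz => ?_⟩
    obtain ⟨c₁, h₁⟩ := hsa (z + star z) (N.add_mem hz (hstar z hz)) (.add_star_self z)
    obtain ⟨c₂, h₂⟩ := hsa (Complex.I • (z - star z))
      (N.smul_mem _ (N.sub_mem hz (hstar z hz))) (by
        simp [IsSelfAdjoint, star_smul, smul_sub]
        abel)
    refine ⟨2⁻¹ * (c₁ - Complex.I * c₂), ?_⟩
    rw [mul_smul, sub_smul, mul_smul, ← h₁, ← h₂, smul_smul, Complex.I_mul_I]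
    module
  · push Not at hN
    refine ⟨0, N.zero_mem, .zero A, by simp, fun z hz => ⟨0, ?_⟩⟩
    have : z * star z = 0 := by
      by_contra h
      exact hN _ (by simpa using hher z hz _ (hstar z hz) 1) h (.mul_star_self z)
    simpa using CStarRing.mul_star_self_eq_zero_iff z |>.mp this

end Hereditary

/-! ### Minimal projections and the dimension bound. -/

/-- A C⋆-algebra that is spanned by the corners of two complementary minimal projections has
dimension at most four. -/
theorem rank_le_four_of_minimal {A : Type*} [CStarAlgebra A] {p r : A}
    (hps : IsSelfAdjoint p) (hrs : IsSelfAdjoint r) (hpr : p + r = 1) (hrr : r * r = r)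
    (hp : ∀ z, ∃ c : ℂ, p * z * p = c • p) (hr : ∀ z, ∃ c : ℂ, r * z * r = c • r) :
    Module.rank ℂ A ≤ 4 := by
  classical
  -- The corner p A r is at most a line: if v ≠ 0 lies in it, v*v is a nonzero multiple of r and w
  -- v* a multiple of p for each w in it, so w v*v is a multiple of both w and v.
  have hcorner : ∃ v : A, ∀ z, ∃ c : ℂ, p * z * r = c • v := by
    by_cases h : ∃ y, p * y * r ≠ 0
    · obtain ⟨y, hy⟩ := h
      refine ⟨p * y * r, fun z => ?_⟩
      obtain ⟨s, hs⟩ := hr (star y * p * p * y)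
      obtain ⟨c, hc⟩ := hp (z * r * r * star y)
      have hv : star (p * y * r) * (p * y * r) = s • r := by
        rw [← hs]; simp [hps.star_eq, hrs.star_eq, mul_assoc]
      have hs0 : s ≠ 0 := by
        rintro rfl
        rw [zero_smul, CStarRing.star_mul_self_eq_zero_iff] at hv
        exact hy hv
      have hzv : p * z * r * star (p * y * r) = c • p := by
        rw [← hc]; simp [hps.star_eq, hrs.star_eq, mul_assoc]
      have hpp : p * (p * y * r) = p * y * r := by
        have : p * p = p := by
          rw [eq_sub_of_add_eq hpr]; simp [mul_sub, sub_mul, hrr]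
        rw [← mul_assoc, ← mul_assoc, this]
      have key : s • (p * z * r) = c • (p * y * r) := by
        calc s • (p * z * r) = p * z * r * (s • r) := by
              rw [mul_smul_comm, mul_assoc _ r r, hrr]
          _ = (p * z * r * star (p * y * r)) * (p * y * r) := by
              rw [← hv, ← mul_assoc (p * z * r)]
          _ = c • (p * y * r) := by rw [hzv, smul_mul_assoc, hpp]
      exact ⟨s⁻¹ * c, by rw [mul_smul, ← key, smul_smul, inv_mul_cancel₀ hs0, one_smul]⟩
    · push Not at h
      exact ⟨0, fun z => ⟨0, by simp [h z]⟩⟩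
  obtain ⟨v, hv⟩ := hcorner
  have hspan : Submodule.span ℂ (({p, r, v, star v} : Finset A) : Set A) = ⊤ := by
    rw [eq_top_iff]
    rintro z -
    have hz : z = p * z * p + r * z * r + p * z * r + star (p * star z * r) := by
      calc z = (p + r) * z * (p + r) := by rw [hpr, one_mul, mul_one]
        _ = _ := by
          simp only [star_mul, star_star, hps.star_eq, hrs.star_eq]
          noncomm_ring
    obtain ⟨c₁, h₁⟩ := hp z
    obtain ⟨c₂, h₂⟩ := hr z
    obtain ⟨c₃, h₃⟩ := hv z
    obtain ⟨c₄, h₄⟩ := hv (star z)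
    rw [hz, h₁, h₂, h₃, h₄, star_smul]
    refine add_mem (add_mem (add_mem ?_ ?_) ?_) ?_ <;>
      exact Submodule.smul_mem _ _ (Submodule.subset_span (by simp))
  rw [← rank_top ℂ A, ← hspan]
  refine (rank_span_finset_le _).trans ?_
  exact_mod_cast Finset.card_le_four

/-- In a C⋆-algebra of dimension at least five, two minimal projections have a common nonzero
annihilator. -/
theorem exists_annihilator_of_minimal {A : Type*} [CStarAlgebra A]
    (hdim : 5 ≤ Module.rank ℂ A) {p q : A}
    (hps : IsSelfAdjoint p) (hqs : IsSelfAdjoint q) (hpp : p * p = p) (hqq : q * q = q)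
    (hp : ∀ z, ∃ c : ℂ, p * z * p = c • p) (hq : ∀ z, ∃ c : ℂ, q * z * q = c • q) (hp1 : p ≠ 1) :
    ∃ x : A, x ≠ 0 ∧ x * p = 0 ∧ x * q = 0 := by
  obtain ⟨r, rfl⟩ : ∃ r, p = 1 - r := ⟨1 - p, by simp⟩
  have hr0 : r ≠ 0 := by rintro rfl; simp at hp1
  have hrs : IsSelfAdjoint r := by
    simpa using (IsSelfAdjoint.one A).sub hps
  have hrr : r * r = r := by
    have : r * r = (1 - r) * (1 - r) - 1 + r + r := by noncomm_ring
    rw [this, hpp]; abel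
  by_cases hqr : r * q = 0
  · exact ⟨r, hr0, by rw [mul_sub, hrr, mul_one, sub_self], hqr⟩
  obtain ⟨c, hc⟩ := hq r
  have hnorm : r * q * star (r * q) = r * q * r := by
    rw [star_mul, hrs.star_eq, hqs.star_eq, mul_assoc r q (q * r), ← mul_assoc q q r, hqq,
      mul_assoc]
  have hh0 : r * q * r ≠ 0 := by
    rwa [← hnorm, Ne, CStarRing.mul_star_self_eq_zero_iff]
  have hsand : ∀ z, ∃ d : ℂ, (r * q * r) * z * (r * q * r) = d • (r * q * r) := by
    intro z
    obtain ⟨d, hd⟩ := hq (r * z * r)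
    refine ⟨d, ?_⟩
    calc (r * q * r) * z * (r * q * r) = r * (q * (r * z * r) * q) * r := by
          simp only [mul_assoc]
      _ = d • (r * q * r) := by rw [hd, mul_smul_comm, smul_mul_assoc]
  have hsq : (r * q * r) * (r * q * r) = c • (r * q * r) := by
    calc (r * q * r) * (r * q * r) = r * (q * (r * r) * q) * r := by simp only [mul_assoc]
      _ = c • (r * q * r) := by rw [hrr, hc, mul_smul_comm, smul_mul_assoc]
  have hc0 : c ≠ 0 := by
    rintro rfl
    have hsa : star (r * q * r) = r * q * r := by
      simp [hrs.star_eq, hqs.star_eq, mul_assoc]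
    rw [zero_smul] at hsq
    nth_rewrite 1 [← hsa] at hsq
    exact hh0 ((CStarRing.star_mul_self_eq_zero_iff _).mp hsq)
  -- If r q r = c r, then r is minimal too and the dimension is at most 4. Otherwise c r - r q r
  -- works, since q r q = c q.
  by_cases he : c • r = r * q * r
  · refine absurd (hdim.trans (rank_le_four_of_minimal hps hrs (by simp) hrr hp fun z => ?_))
      (by norm_num)
    obtain ⟨d, hd⟩ := hsand z
    rw [← he, smul_mul_assoc, smul_mul_assoc, mul_smul_comm, smul_smul, smul_smul] at hd
    refine ⟨(c * c)⁻¹ * (d * c), ?_⟩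
    rw [mul_smul, ← hd, smul_smul, inv_mul_cancel₀ (mul_ne_zero hc0 hc0), one_smul]
  · refine ⟨c • r - r * q * r, sub_ne_zero.mpr he, ?_, ?_⟩
    · have : r * (1 - r) = 0 := by rw [mul_sub, hrr, mul_one, sub_self]
      rw [sub_mul, smul_mul_assoc, this, mul_assoc, this, smul_zero, mul_zero, sub_self]
    · calc (c • r - r * q * r) * q = c • (r * q) - r * (q * r * q) := by
            simp only [sub_mul, smul_mul_assoc, mul_assoc]
        _ = 0 := by rw [hc, mul_smul_comm, sub_self]

/-! ### Paths in the zero divisor graph. -/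

section Graph

variable {A : Type*} [CStarAlgebra A]

theorem isPosZeroDivisor_mul_star {c b : A} (hc : c ≠ 0) (hb : b ≠ 0) (h : b * c = 0) :
    IsPosZeroDivisor (c * star c) :=
  ⟨by rwa [Ne, CStarRing.mul_star_self_eq_zero_iff], ⟨c, rfl⟩, b, hb,
    Or.inr (by rw [← mul_assoc, h, zero_mul])⟩

theorem exists_mul_eq_zero_of_isPosZeroDivisor {a : A} (ha : IsPosZeroDivisor a) :
    ∃ b : A, b ≠ 0 ∧ a * b = 0 := by
  obtain ⟨b, hb, h | h⟩ := ha.2.2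
  · exact ⟨b, hb, h⟩
  · refine ⟨star b, star_ne_zero.mpr hb, ?_⟩
    have := congrArg star h
    rwa [star_mul, ha.star_eq, star_zero] at this

/-- Distinctness is automatic, as a self-adjoint element of square zero vanishes. -/
theorem posZeroDivisorGraph_edist_le_one {u v : {a : A // IsPosZeroDivisor a}}
    (h : (u : A) * v = 0) : (posZeroDivisorGraph A).edist u v ≤ 1 := by
  have hne : u ≠ v := by
    rintro rfl
    refine u.2.1 ((CStarRing.star_mul_self_eq_zero_iff _).mp ?_)
    rwa [u.2.star_eq]
  have hadj : (posZeroDivisorGraph A).Adj u v := ⟨hne, h⟩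
  exact (SimpleGraph.edist_eq_one_iff_adj.mpr hadj).le

theorem posZeroDivisorGraph_edist_le_two {u v : {a : A // IsPosZeroDivisor a}} {d : A}
    (hd : d ≠ 0) (hu : (u : A) * d = 0) (hv : (v : A) * d = 0) :
    (posZeroDivisorGraph A).edist u v ≤ 2 := by
  let w : {a : A // IsPosZeroDivisor a} := ⟨d * star d, isPosZeroDivisor_mul_star hd u.2.1 hu⟩
  have huw : (posZeroDivisorGraph A).edist u w ≤ 1 :=
    posZeroDivisorGraph_edist_le_one (by simp [w, ← mul_assoc, hu])
  have hvw : (posZeroDivisorGraph A).edist v w ≤ 1 :=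
    posZeroDivisorGraph_edist_le_one (by simp [w, ← mul_assoc, hv])
  calc _ ≤ (posZeroDivisorGraph A).edist u w + (posZeroDivisorGraph A).edist w v :=
        SimpleGraph.edist_triangle
    _ ≤ 1 + 1 := add_le_add huw (by rwa [SimpleGraph.edist_comm])
    _ = 2 := one_add_one_eq_two

/-- The path is u, dd*, x*x, ee*, v. -/
theorem posZeroDivisorGraph_edist_le_four {u v : {a : A // IsPosZeroDivisor a}} {d x e : A}
    (hd : d ≠ 0) (hx : x ≠ 0) (he : e ≠ 0) (hu : (u : A) * d = 0) (hxd : x * d = 0)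
    (hxe : x * e = 0) (hv : (v : A) * e = 0) :
    (posZeroDivisorGraph A).edist u v ≤ 4 := by
  have hdx : star d * star x = 0 := by rw [← star_mul, hxd, star_zero]
  let w : {a : A // IsPosZeroDivisor a} :=
    ⟨star x * star (star x),
      isPosZeroDivisor_mul_star (star_ne_zero.mpr hx) (star_ne_zero.mpr hd) hdx⟩
  have huw : (posZeroDivisorGraph A).edist u w ≤ 2 :=
    posZeroDivisorGraph_edist_le_two hd hu (by simp [w, mul_assoc, hxd])
  have hwv : (posZeroDivisorGraph A).edist w v ≤ 2 :=
    posZeroDivisorGraph_edist_le_two he (by simp [w, mul_assoc, hxe]) hv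
  calc _ ≤ (posZeroDivisorGraph A).edist u w + (posZeroDivisorGraph A).edist w v :=
        SimpleGraph.edist_triangle
    _ ≤ 2 + 2 := add_le_add huw hwv
    _ = 4 := by norm_num

/-- The two-sided annihilator of `w`. -/
noncomputable def twoSidedAnnihilator (w : A) : Submodule ℂ A :=
  LinearMap.ker (LinearMap.mulLeft ℂ w) ⊓ LinearMap.ker (LinearMap.mulRight ℂ w)

theorem mem_twoSidedAnnihilator {w z : A} :
    z ∈ twoSidedAnnihilator w ↔ w * z = 0 ∧ z * w = 0 := by
  simp [twoSidedAnnihilator]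

theorem sandwich_mem_twoSidedAnnihilator {w x y : A} (hx : x ∈ twoSidedAnnihilator w)
    (hy : y ∈ twoSidedAnnihilator w) (t : A) : x * t * y ∈ twoSidedAnnihilator w := by
  rw [mem_twoSidedAnnihilator] at *
  refine ⟨by rw [← mul_assoc, ← mul_assoc, hx.1, zero_mul, zero_mul], ?_⟩
  rw [mul_assoc, hy.2, mul_zero]

theorem star_mem_twoSidedAnnihilator {w z : A} (hw : IsSelfAdjoint w)
    (hz : z ∈ twoSidedAnnihilator w) : star z ∈ twoSidedAnnihilator w := by
  rw [mem_twoSidedAnnihilator] at *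
  constructor
  · simpa [hw.star_eq] using congrArg star hz.2
  · simpa [hw.star_eq] using congrArg star hz.1

/-- Vertices at distance more than four have annihilators spanned by a projection. -/
theorem exists_projection_or_edist_le_four (u v : {a : A // IsPosZeroDivisor a}) :
    (posZeroDivisorGraph A).edist u v ≤ 4 ∨
      ∃ p ∈ twoSidedAnnihilator (v : A), IsSelfAdjoint p ∧ p * p = p ∧
        ∀ z ∈ twoSidedAnnihilator (v : A), ∃ c : ℂ, z = c • p := by
  have hvs : IsSelfAdjoint (v : A) := v.2.star_eq
  have hus : IsSelfAdjoint (u : A) := u.2.star_eq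
  by_cases hprime : ∀ x ∈ twoSidedAnnihilator (v : A), ∀ y ∈ twoSidedAnnihilator (v : A),
      x * (u : A) * y = 0 → x = 0 ∨ y = 0
  · exact Or.inr (exists_projection_of_sandwich_prime
      (fun z hz => star_mem_twoSidedAnnihilator hvs hz)
      (fun x hx y hy t => sandwich_mem_twoSidedAnnihilator hx hy t) hus hprime)
  · left
    push Not at hprime
    obtain ⟨x, hx, y, hy, hxy, hx0, hy0⟩ := hprime
    by_cases hxu : x * (u : A) = 0
    · refine (posZeroDivisorGraph_edist_le_two (star_ne_zero.mpr hx0) ?_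
        (mem_twoSidedAnnihilator.mp (star_mem_twoSidedAnnihilator hvs hx)).1).trans
          (by norm_num)
      simpa [hus.star_eq] using congrArg star hxu
    · obtain ⟨d, hd0, hd⟩ := exists_mul_eq_zero_of_isPosZeroDivisor u.2
      exact posZeroDivisorGraph_edist_le_four hd0 hxu hy0 hd (by rw [mul_assoc, hd, mul_zero])
        hxy (mem_twoSidedAnnihilator.mp hy).1

theorem posZeroDivisorGraph_edist_le_four_of_five_le_rank (hdim : 5 ≤ Module.rank ℂ A)
    (u v : {a : A // IsPosZeroDivisor a}) : (posZeroDivisorGraph A).edist u v ≤ 4 := by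
  rcases exists_projection_or_edist_le_four u v with h | ⟨q, hq, hqs, hqq, hqmin⟩
  · exact h
  rcases exists_projection_or_edist_le_four v u with h | ⟨p, hp, hps, hpp, hpmin⟩
  · rwa [SimpleGraph.edist_comm]
  have ne_zero : ∀ (w : {a : A // IsPosZeroDivisor a}) (e : A),
      (∀ z ∈ twoSidedAnnihilator (w : A), ∃ c : ℂ, z = c • e) → e ≠ 0 := by
    rintro w e he rfl
    obtain ⟨b, hb0, hb⟩ := exists_mul_eq_zero_of_isPosZeroDivisor w.2
    have hb' : b * star b ∈ twoSidedAnnihilator (w : A) := by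
      refine mem_twoSidedAnnihilator.mpr ⟨by rw [← mul_assoc, hb, zero_mul], ?_⟩
      have : star b * (w : A) = 0 := by simpa [w.2.star_eq] using congrArg star hb
      rw [mul_assoc, this, mul_zero]
    obtain ⟨c, hc⟩ := he _ hb'
    rw [smul_zero, CStarRing.mul_star_self_eq_zero_iff] at hc
    exact hb0 hc
  have hup := (mem_twoSidedAnnihilator.mp hp).1
  have hvq := (mem_twoSidedAnnihilator.mp hq).1
  obtain ⟨x, hx0, hxp, hxq⟩ := exists_annihilator_of_minimal hdim hps hqs hpp hqq
    (fun z => hpmin _ (sandwich_mem_twoSidedAnnihilator hp hp z))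
    (fun z => hqmin _ (sandwich_mem_twoSidedAnnihilator hq hq z))
    (by rintro rfl; exact u.2.1 (by simpa using hup))
  exact posZeroDivisorGraph_edist_le_four (ne_zero u p hpmin) hx0 (ne_zero v q hqmin) hup hxp
    hxq hvq

theorem nonempty_isPosZeroDivisor (hdim : 5 ≤ Module.rank ℂ A) :
    Nonempty {a : A // IsPosZeroDivisor a} := by
  by_contra hempty
  -- Without vertices A has no zero divisors, so the projection lemma with a = 1 makes A at most
  -- one-dimensional.
  obtain ⟨p, -, -, -, hp⟩ := exists_projection_of_sandwich_prime (N := (⊤ : Submodule ℂ A))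
    (a := 1) (by simp) (by simp) (.one A) (by
      intro x _ y _ hxy
      by_contra! h
      exact hempty ⟨_, isPosZeroDivisor_mul_star h.2 h.1 (by simpa using hxy)⟩)
  have hspan : Submodule.span ℂ (({p} : Finset A) : Set A) = ⊤ := by
    rw [eq_top_iff]
    rintro z -
    obtain ⟨c, rfl⟩ := hp z trivial
    exact Submodule.smul_mem _ _ (Submodule.subset_span (by simp))
  have hle := rank_span_finset_le (R := ℂ) ({p} : Finset A)
  rw [hspan, rank_top] at hle
  exact absurd (hdim.trans hle) (by norm_num)

theorem posZeroDivisorGraph_connected_and_ediam_le_four (hdim : 5 ≤ Module.rank ℂ A) :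
    (posZeroDivisorGraph A).Connected ∧ (posZeroDivisorGraph A).ediam ≤ 4 := by
  have hdist := posZeroDivisorGraph_edist_le_four_of_five_le_rank hdim
  have := nonempty_isPosZeroDivisor hdim
  refine ⟨⟨fun u v => SimpleGraph.reachable_of_edist_ne_top ?_⟩,
    SimpleGraph.ediam_le_of_edist_le hdist⟩
  exact ne_top_of_le_ne_top (by decide) (hdist u v)

end Graph

/-! ### Transfer to von Neumann algebras. -/

/-- A is its own bicommutant and centralizers are norm closed; this makes A a C⋆-algebra. -/
theorem VonNeumannAlgebra.isClosed {H : Type*} [NormedAddCommGroup H] [InnerProductSpace ℂ H]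
    [CompleteSpace H] (A : VonNeumannAlgebra H) :
    IsClosed (A.toStarSubalgebra : Set (H →L[ℂ] H)) := by
  rw [VonNeumannAlgebra.coe_toStarSubalgebra, ← A.centralizer_centralizer]
  exact Set.isClosed_centralizer _

theorem mainTheorem4 {H : Type*} [NormedAddCommGroup H] [InnerProductSpace ℂ H] [CompleteSpace H]
    (A : VonNeumannAlgebra H) (hA : A.IsFactor)
    (hdim : 5 ≤ Module.rank ℂ A.toStarSubalgebra) :
    (posZeroDivisorGraph A.toStarSubalgebra).Connected ∧
      (posZeroDivisorGraph A.toStarSubalgebra).ediam ≤ 4 := by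
  have : IsClosed (A.toStarSubalgebra : Set (H →L[ℂ] H)) := A.isClosed
  exact posZeroDivisorGraph_connected_and_ediam_le_four hdim
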